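/- For a finite simple graph $\Gamma$ let $G(\Gamma)=\langle\, v\in V(\Gamma)\mid uv=vu \text{ whenever } \{u,v\}\notin E(\Gamma)\,\rangle$ be the right-angled Artin group in which non-adjacent vertices commute. A map of graphs $\phi:\Lambda\to\Gamma$ between finite simple graphs (a map of vertices sending adjacent vertices to adjacent vertices) induces a homomorphism $\phi^*:G(\Gamma)\to G(\Lambda)$, $\phi^*(v)=\prod_{v'\in\phi^{-1}(v)}v'$ (the factors commute; the empty product is $1$). It is called an immersion if for every vertex $v'$ of $\Lambda$ it is injective on the set of neighbours of $v'$. For $m\ge 2$ let $\Gamma_m$ be the following graph with $m$ vertices. If $m=2k+1$, its vertices are $v_0,v_1,u_1,\dots,v_k,u_k$; if $m=2k+2$, its vertices are $v_0,v_1,u_1,\dots,v_k,u_k,v_{k+1}$. Two vertices are adjacent if and only if their indices differ by exactly $1$. (Thus $\Gamma_2$ is a single edge.) Theorem. Let $m\ge 2$ be an integer, let $T$ be a finite tree and let $\phi:T\to\Gamma_m$ be an immersion such that $\phi^*:G(\Gamma_m)\to G(T)$ is injective. Then $|V(T)|\ge 2^{m/4}$. -/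

import Mathlib

namespace RAAG

/-- Defining relators of `G Γ`: the commutators of pairs of non-adjacent vertices. -/
def relators {V : Type*} (Γ : SimpleGraph V) : Set (FreeGroup V) :=
  {r | ∃ u v : V, ¬ Γ.Adj u v ∧
    r = FreeGroup.of u * FreeGroup.of v * (FreeGroup.of u)⁻¹ * (FreeGroup.of v)⁻¹}

/-- The right-angled Artin group `⟨v ∈ V(Γ) | [u, v] = 1 if {u, v} ∉ E(Γ)⟩`, i.e. the convention in
which *non-adjacent* vertices commute. -/
abbrev G {V : Type*} (Γ : SimpleGraph V) : Type _ := PresentedGroup (relators Γ)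

/-- The generator of `G Γ` given by a vertex. -/
def gen {V : Type*} (Γ : SimpleGraph V) (v : V) : G Γ := PresentedGroup.of v

theorem gen_commute {V : Type*} (Γ : SimpleGraph V) {u v : V} (h : ¬ Γ.Adj u v) :
    Commute (gen Γ u) (gen Γ v) := by
  have h1 : gen Γ u * gen Γ v * (gen Γ u)⁻¹ * (gen Γ v)⁻¹ = 1 :=
    PresentedGroup.one_of_mem (rels := relators Γ) ⟨u, v, h, rfl⟩
  exact mul_inv_eq_iff_eq_mul.mp (mul_inv_eq_one.mp h1)

theorem gen_commute_of_fiber {W V : Type*} {L : SimpleGraph W} {Γ : SimpleGraph V}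
    (φ : L →g Γ) {u v : V} (h : ¬ Γ.Adj u v) {x y : W} (hx : φ x = u) (hy : φ y = v) : Commute (gen L x) (gen L y) := by
  refine gen_commute L fun hxy => h ?_
  rw [← hx, ← hy]
  exact φ.map_adj hxy

section Pullback

variable {W V : Type*} [Fintype W] [DecidableEq V]
  {L : SimpleGraph W} {Γ : SimpleGraph V}

/-- The product in `G L` of all vertices in the fibre `φ⁻¹(v)` (these commute pairwise). It is the
identity if the fibre is empty. -/
def fiberProd (φ : L →g Γ) (v : V) : G L :=
  (Finset.univ.filter fun x : W => φ x = v).noncommProd (gen L) (by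
    intro x hx y hy _
    simp only [Finset.coe_filter, Finset.mem_univ, true_and, Set.mem_ofPred_eq] at hx hy
    exact gen_commute_of_fiber φ (Γ.loopless.irrefl v) hx hy)

theorem fiberProd_commute (φ : L →g Γ) {u v : V} (h : ¬ Γ.Adj u v) :
    Commute (fiberProd φ u) (fiberProd φ v) := by
  unfold fiberProd
  refine Finset.noncommProd_commute _ _ _ _ fun y hy => Commute.symm ?_
  refine Finset.noncommProd_commute _ _ _ _ fun x hx => ?_
  simp only [Finset.mem_filter, Finset.mem_univ, true_and] at hx hy
  exact (gen_commute_of_fiber φ h hx hy).symm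

theorem fiberProd_relators (φ : L →g Γ) :
    ∀ r ∈ relators Γ, FreeGroup.lift (fiberProd φ) r = 1 := by
  rintro r ⟨u, v, h, rfl⟩
  simp only [map_mul, map_inv, FreeGroup.lift_apply_of]
  exact mul_inv_eq_one.mpr (mul_inv_eq_iff_eq_mul.mpr (fiberProd_commute φ h))

/-- The homomorphism `φ^* : G Γ → G L` with `φ^* v = ∏_{x ∈ φ⁻¹(v)} x` induced by a map of graphs
`φ : L → Γ`. -/
def pullback (φ : L →g Γ) : G Γ →* G L := PresentedGroup.toGroup (fiberProd_relators φ)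

end Pullback

/-- A map of graphs is an immersion if it is injective on the link of every vertex. -/
def IsImmersion {W V : Type*} {L : SimpleGraph W} {Γ : SimpleGraph V} (φ : L →g Γ) : Prop :=
  ∀ x : W, Set.InjOn φ (L.neighborSet x)

/-- The graph `Γ_m` on `m` vertices `0, …, m - 1`. The vertex `0` is `v_0`; for `i ≥ 1` the vertices
`2 i - 1` and `2 i` are `v_i` and `u_i` (if `m` is even, the last vertex `m - 1 = 2 (m / 2) - 1` has
no partner). So `j` has index `(j + 1) / 2` (rounded down), and two vertices are adjacent exactly
when their indices differ by one. -/
def ladder (m : ℕ) : SimpleGraph (Fin m) where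
  Adj a b := (a.val + 1) / 2 + 1 = (b.val + 1) / 2 ∨ (b.val + 1) / 2 + 1 = (a.val + 1) / 2
  symm := ⟨fun _ _ h => h.symm⟩
  loopless := ⟨fun _ h => by omega⟩

end RAAG

namespace RAAG

open Finset
open scoped commutatorElement

/-! Choosing one of `u_i`, `v_i` at each level that has both gives `2 ^ ((m - 1) / 2)` induced paths
in `Γ_m`, running from the first level to the last. The left-normed commutator along such a path is
nontrivial (`iteratedCommutator_gen_ne_one`), but `φ^*` kills it when the path has no lift
(`iteratedCommutator_fiberProd_eq_one`). So injectivity makes every path lift to `T`. In a tree the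
endpoints determine the lift, so the number of paths is at most the product of the sizes of two
disjoint vertex sets, hence at most `|V(T)|² / 4`. -/

/-- The left-normed commutator `[[…[a 0, a 1], …], a j]`. -/
def iteratedCommutator {H : Type*} [Group H] (a : ℕ → H) : ℕ → H
  | 0 => a 0
  | j + 1 => ⁅iteratedCommutator a j, a (j + 1)⁆

theorem map_iteratedCommutator {H K : Type*} [Group H] [Group K] (f : H →* K) (a : ℕ → H) (j : ℕ) :
    f (iteratedCommutator a j) = iteratedCommutator (fun i => f (a i)) j := by
  induction j with
  | zero => rfl
  | succ j ih => simp only [iteratedCommutator, map_commutatorElement, ih]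

/-! ### Unipotent matrices detecting iterated commutators -/

section Transvection

/-- The elementary transvection `1 + E_{ab}` acting on integer sequences. -/
def transvectionPerm (a b : ℕ) (h : a ≠ b) : Equiv.Perm (ℕ → ℤ) where
  toFun f := fun i => if i = a then f i + f b else f i
  invFun f := fun i => if i = a then f i - f b else f i
  left_inv f := by
    funext i
    simp only [h.symm, if_false]
    split_ifs <;> ring
  right_inv f := by
    funext i
    simp only [h.symm, if_false]
    split_ifs <;> ring

theorem transvectionPerm_apply {a b : ℕ} (h : a ≠ b) (f : ℕ → ℤ) (i : ℕ) :
    transvectionPerm a b h f i = if i = a then f i + f b else f i := rfl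

/-- Both products `E_{ab} E_{cd}` and `E_{cd} E_{ab}` vanish. -/
theorem transvectionPerm_commute {a b c d : ℕ} (hab : a ≠ b) (hcd : c ≠ d) (hbc : b ≠ c)
    (hda : d ≠ a) : Commute (transvectionPerm a b hab) (transvectionPerm c d hcd) := by
  refine Equiv.ext fun f => funext fun i => ?_
  simp only [Equiv.Perm.mul_apply, transvectionPerm_apply, hbc, hda, if_false]
  split_ifs <;> ring

theorem transvectionPerm_commutator {a b c : ℕ} (hab : a ≠ b) (hbc : b ≠ c) (hac : a ≠ c) :
    ⁅transvectionPerm a b hab, transvectionPerm b c hbc⁆ = transvectionPerm a c hac := by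
  rw [commutatorElement_def, mul_inv_eq_iff_eq_mul, mul_inv_eq_iff_eq_mul]
  refine Equiv.ext fun f => funext fun i => ?_
  simp only [Equiv.Perm.mul_apply, transvectionPerm_apply, hbc.symm, hac.symm, if_false, if_true]
  split_ifs <;> omega

theorem transvectionPerm_ne_one {a b : ℕ} (h : a ≠ b) : transvectionPerm a b h ≠ 1 := by
  intro h1
  have := congrFun (congrArg (fun e : Equiv.Perm (ℕ → ℤ) => e (fun _ => 1)) h1) a
  simp [transvectionPerm_apply] at this

theorem iteratedCommutator_transvectionPerm (j : ℕ) :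
    iteratedCommutator (fun i => transvectionPerm i (i + 1) (Nat.succ_ne_self i).symm) j =
      transvectionPerm 0 (j + 1) (Nat.succ_ne_zero j).symm := by
  induction j with
  | zero => rfl
  | succ j ih =>
    rw [iteratedCommutator, ih, transvectionPerm_commutator]

end Transvection

theorem iteratedCommutator_congr {H : Type*} [Group H] {a b : ℕ → H} {j : ℕ}
    (h : ∀ i ≤ j, a i = b i) : iteratedCommutator a j = iteratedCommutator b j := by
  induction j with
  | zero => exact h 0 le_rfl
  | succ j ih =>
    rw [iteratedCommutator, iteratedCommutator, ih fun i hi => h i (by omega), h _ le_rfl]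

/-- The left-normed commutator along an induced path `x 0, …, x K`, graded by a level function,
is nontrivial. -/
theorem iteratedCommutator_gen_ne_one {V : Type*} {Γ : SimpleGraph V} (lvl : V → ℕ)
    (hadj : ∀ u v, lvl u + 1 = lvl v → Γ.Adj u v) (x : ℕ → V) (K : ℕ)
    (hx : ∀ i ≤ K, lvl (x i) = i) :
    iteratedCommutator (fun i => gen Γ (x i)) K ≠ 1 := by
  classical
  let t : ℕ → Equiv.Perm (ℕ → ℤ) := fun i => transvectionPerm i (i + 1) (Nat.succ_ne_self i).symm
  -- Vertices on the path act by consecutive transvections, all others trivially; only consecutive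
  -- levels can fail to commute.
  let F : V → Equiv.Perm (ℕ → ℤ) := fun v => if x (lvl v) = v then t (lvl v) else 1
  have hF : ∀ u v, ¬ Γ.Adj u v → Commute (F u) (F v) := by
    intro u v huv
    have h1 : lvl u + 1 ≠ lvl v := fun h => huv (hadj u v h)
    have h2 : lvl v + 1 ≠ lvl u := fun h => huv (hadj v u h).symm
    simp only [F]
    split_ifs
    · exact transvectionPerm_commute _ _ h1 h2
    · exact Commute.one_right _
    · exact Commute.one_left _
    · exact Commute.one_left _
  have hrel : ∀ r ∈ relators Γ, FreeGroup.lift F r = 1 := by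
    rintro r ⟨u, v, h, rfl⟩
    simp only [map_mul, map_inv, FreeGroup.lift_apply_of]
    exact mul_inv_eq_one.mpr (mul_inv_eq_iff_eq_mul.mpr (hF u v h))
  let ρ : G Γ →* Equiv.Perm (ℕ → ℤ) := PresentedGroup.toGroup hrel
  intro h
  have h1 := congrArg ρ h
  rw [map_iteratedCommutator, map_one] at h1
  rw [iteratedCommutator_congr (b := t), iteratedCommutator_transvectionPerm] at h1
  · exact transvectionPerm_ne_one _ h1
  · intro i hi
    have : ρ (gen Γ (x i)) = F (x i) := PresentedGroup.toGroup.of hrel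
    rw [this]
    simp only [F, hx i hi, if_true]

/-! ### Commutators and lifts of paths -/

section Lifting

variable {W V : Type*} {L : SimpleGraph W} {Γ : SimpleGraph V}

/-- The vertices of `L` at which some lift of the path `x 0, …, x j` ends. -/
def liftEnds (φ : L →g Γ) (x : ℕ → V) (j : ℕ) : Set W :=
  {y | ∃ z, ∃ p : L.Walk z y, p.support.map φ = (List.range (j + 1)).map x}

theorem map_of_mem_liftEnds {φ : L →g Γ} {x : ℕ → V} {j : ℕ} {y : W}
    (hy : y ∈ liftEnds φ x j) : φ y = x j := by
  obtain ⟨z, p, hp⟩ := hy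
  have h := congrArg List.getLast? hp
  rw [List.getLast?_map, List.getLast?_map, List.getLast?_range,
    List.getLast?_eq_getLast_of_ne_nil p.support_ne_nil, p.getLast_support] at h
  simpa using h

theorem mem_liftEnds_zero {φ : L →g Γ} {x : ℕ → V} {y : W} (hy : φ y = x 0) :
    y ∈ liftEnds φ x 0 := ⟨y, .nil, by simp [hy]⟩

theorem mem_liftEnds_succ {φ : L →g Γ} {x : ℕ → V} {j : ℕ} {y y' : W}
    (hy : y ∈ liftEnds φ x j) (h : L.Adj y y') (hy' : φ y' = x (j + 1)) :
    y' ∈ liftEnds φ x (j + 1) := by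
  obtain ⟨z, p, hp⟩ := hy
  refine ⟨z, p.concat h, ?_⟩
  rw [SimpleGraph.Walk.support_concat, List.range_succ (n := j + 1), List.map_append, List.map_append, hp]
  simp [hy']

/-- The subgroup generated by the ends of lifts of initial segments of `x 0, …, x j`. -/
def liftSubgroup (φ : L →g Γ) (x : ℕ → V) (j : ℕ) : Subgroup (G L) :=
  Subgroup.closure (gen L '' ⋃ i ≤ j, liftEnds φ x i)

theorem gen_mem_liftSubgroup {φ : L →g Γ} {x : ℕ → V} {i j : ℕ} (hij : i ≤ j) {y : W}
    (hy : y ∈ liftEnds φ x i) : gen L y ∈ liftSubgroup φ x j :=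
  Subgroup.subset_closure ⟨y, Set.mem_biUnion hij hy, rfl⟩

theorem liftSubgroup_mono (φ : L →g Γ) (x : ℕ → V) : Monotone (liftSubgroup φ x) := by
  intro i j hij
  refine Subgroup.closure_mono (Set.image_mono ?_)
  exact Set.biUnion_subset_biUnion_left fun k hk => le_trans hk hij

theorem mem_centralizer_liftSubgroup {φ : L →g Γ} {x : ℕ → V} {j : ℕ} {g : G L}
    (h : ∀ i ≤ j, ∀ y ∈ liftEnds φ x i, Commute (gen L y) g) :
    g ∈ Subgroup.centralizer (liftSubgroup φ x j : Set (G L)) := by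
  rw [liftSubgroup, Subgroup.centralizer_closure, Subgroup.mem_centralizer_iff]
  rintro _ ⟨y, hy, rfl⟩
  obtain ⟨i, hi, hy⟩ := Set.mem_iUnion₂.mp hy
  exact h i hi y hy

/-- A neighbour of `y` among the lift ends would lie over `x j`, the path being induced, and its
lift would then extend to `y`. -/
theorem gen_mem_centralizer_liftSubgroup {φ : L →g Γ} {x : ℕ → V} {K j k : ℕ}
    (hx : ∀ i ≤ K, ∀ j ≤ K, Γ.Adj (x i) (x j) → i + 1 = j ∨ j + 1 = i)
    (hj : j + 1 ≤ K) (hk : k ≤ j + 1) {y : W} (hy : φ y = x (j + 1))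
    (hy' : y ∉ liftEnds φ x (j + 1)) :
    gen L y ∈ Subgroup.centralizer (liftSubgroup φ x k : Set (G L)) := by
  refine mem_centralizer_liftSubgroup fun i hi z hz => gen_commute L fun hzy => hy' ?_
  have h := φ.map_adj hzy
  rw [hy, map_of_mem_liftEnds hz] at h
  obtain rfl : i = j := by
    have := hx i (by omega) (j + 1) hj h
    omega
  exact mem_liftEnds_succ hz hzy hy

variable [Fintype W] [DecidableEq V]

theorem fiberProd_mem {φ : L →g Γ} {v : V} (H : Subgroup (G L))
    (h : ∀ y, φ y = v → gen L y ∈ H) : fiberProd φ v ∈ H :=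
  Subgroup.noncommProd_mem _ _ fun y hy => h y (by simpa using hy)

theorem pullback_gen (φ : L →g Γ) (v : V) : pullback φ (gen Γ v) = fiberProd φ v :=
  PresentedGroup.toGroup.of _

/-- Each vertex over `x (j + 1)` either ends a lift, and so lies in the subgroup, or centralizes it.
The fibre product therefore normalizes the subgroup. -/
theorem iteratedCommutator_mem_liftSubgroup (φ : L →g Γ) {x : ℕ → V} {K : ℕ}
    (hx : ∀ i ≤ K, ∀ j ≤ K, Γ.Adj (x i) (x j) → i + 1 = j ∨ j + 1 = i) {j : ℕ} (hj : j ≤ K) :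
    iteratedCommutator (fun i => fiberProd φ (x i)) j ∈ liftSubgroup φ x j := by
  induction j with
  | zero =>
    exact fiberProd_mem _ fun y hy => gen_mem_liftSubgroup le_rfl (mem_liftEnds_zero hy)
  | succ j ih =>
    have hw := liftSubgroup_mono φ x (Nat.le_succ j) (ih (by omega))
    have ha : fiberProd φ (x (j + 1)) ∈ Subgroup.normalizer (liftSubgroup φ x (j + 1)) := by
      refine fiberProd_mem _ fun y hy => ?_
      by_cases hy' : y ∈ liftEnds φ x (j + 1)
      · exact Subgroup.le_normalizer (gen_mem_liftSubgroup le_rfl hy')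
      · exact Subgroup.centralizer_le_normalizer _
          (gen_mem_centralizer_liftSubgroup hx hj le_rfl hy hy')
    rw [iteratedCommutator, commutatorElement_def, mul_assoc, mul_assoc, ← mul_assoc (fiberProd _ _)]
    exact mul_mem hw ((Subgroup.mem_normalizer_iff.mp ha _).mp (inv_mem hw))

/-- If the induced path `x 0, …, x K` has no lift to `L`, then `φ^*` kills the left-normed
commutator along it. -/
theorem iteratedCommutator_fiberProd_eq_one (φ : L →g Γ) {x : ℕ → V} {K : ℕ}
    (hx : ∀ i ≤ K, ∀ j ≤ K, Γ.Adj (x i) (x j) → i + 1 = j ∨ j + 1 = i)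
    (hK : liftEnds φ x K = ∅) :
    iteratedCommutator (fun i => fiberProd φ (x i)) K = 1 := by
  cases K with
  | zero =>
    refine Subgroup.mem_bot.mp (fiberProd_mem (⊥ : Subgroup (G L)) fun y hy => ?_)
    exact absurd (mem_liftEnds_zero hy) (hK ▸ Set.notMem_empty y)
  | succ j =>
    have hw := iteratedCommutator_mem_liftSubgroup φ hx (Nat.le_succ j)
    -- With no lift ends over the last vertex, its whole fibre falls in the centralizing case.
    have ha : fiberProd φ (x (j + 1)) ∈ Subgroup.centralizer (liftSubgroup φ x j : Set (G L)) :=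
      fiberProd_mem _ fun y hy => gen_mem_centralizer_liftSubgroup hx le_rfl (Nat.le_succ j) hy
        (hK ▸ Set.notMem_empty y)
    exact commutatorElement_eq_one_iff_mul_comm.mpr (Subgroup.mem_centralizer_iff.mp ha _ hw)

/-- If `φ^*` is injective, then every induced path, graded by a level function, lifts. -/
theorem liftEnds_nonempty (φ : L →g Γ) (hinj : Function.Injective (pullback φ)) (lvl : V → ℕ)
    (hadj : ∀ u v, Γ.Adj u v ↔ lvl u + 1 = lvl v ∨ lvl v + 1 = lvl u) (x : ℕ → V) (K : ℕ)
    (hx : ∀ i ≤ K, lvl (x i) = i) : (liftEnds φ x K).Nonempty := by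
  rw [Set.nonempty_iff_ne_empty]
  intro hK
  refine iteratedCommutator_gen_ne_one lvl (fun u v h => (hadj u v).mpr (.inl h)) x K hx
    (hinj ?_)
  rw [map_iteratedCommutator, map_one]
  simp only [pullback_gen]
  refine iteratedCommutator_fiberProd_eq_one φ (fun i hi j hj h => ?_) hK
  rwa [hadj, hx i hi, hx j hj] at h

end Lifting

/-! ### Counting lifts by their endpoints -/

section Counting

variable {W V : Type*} {T : SimpleGraph W} {Γ : SimpleGraph V}

/-- In a forest, a vertex sequence without repetitions is determined by the endpoints of a lift. -/
theorem map_eq_of_lifts_of_isAcyclic (hT : T.IsAcyclic) (φ : T →g Γ) {l l' : List V}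
    (hl : l.Nodup) (hl' : l'.Nodup) {a b : W} {p q : T.Walk a b} (hp : p.support.map φ = l)
    (hq : q.support.map φ = l') : l = l' := by
  -- A walk whose image has no repetitions has none itself.
  have hp' : p.IsPath := (SimpleGraph.Walk.isPath_def p).mpr (List.Nodup.of_map φ (hp ▸ hl))
  have hq' : q.IsPath := (SimpleGraph.Walk.isPath_def q).mpr (List.Nodup.of_map φ (hq ▸ hl'))
  have h : p = q := congrArg Subtype.val
    ((hT.subsingleton_path a b).elim ⟨p, hp'⟩ ⟨q, hq'⟩)
  rw [← hp, ← hq, h]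

/-- The path in `Γ_m` that passes through `u_i` for `i ∈ s` and through `v_i` otherwise. -/
def ladderPath (m : ℕ) (hm : 0 < m) (s : Finset ℕ) (i : ℕ) : Fin m :=
  -- At `i = 0` truncated subtraction gives `v_0`. The default is not reached for `i ≤ m / 2` and `s
  -- ⊆ Icc 1 ((m - 1) / 2)`, the levels with two vertices.
  if h : (if i ∈ s then 2 * i else 2 * i - 1) < m then ⟨_, h⟩ else ⟨0, hm⟩

theorem ladderPath_val {m : ℕ} (hm : 0 < m) {s : Finset ℕ} (hs : s ⊆ Icc 1 ((m - 1) / 2)) {i : ℕ}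
    (hi : i ≤ m / 2) : (ladderPath m hm s i).val = if i ∈ s then 2 * i else 2 * i - 1 := by
  have h : (if i ∈ s then 2 * i else 2 * i - 1) < m := by
    split_ifs with his
    · have := mem_Icc.mp (hs his)
      omega
    · omega
  rw [ladderPath, dif_pos h]

theorem level_ladderPath {m : ℕ} (hm : 0 < m) {s : Finset ℕ} (hs : s ⊆ Icc 1 ((m - 1) / 2)) {i : ℕ}
    (hi : i ≤ m / 2) : ((ladderPath m hm s i).val + 1) / 2 = i := by
  rw [ladderPath_val hm hs hi]
  split_ifs <;> omega

theorem nodup_map_ladderPath {m : ℕ} (hm : 0 < m) {s : Finset ℕ} (hs : s ⊆ Icc 1 ((m - 1) / 2)) :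
    ((List.range (m / 2 + 1)).map (ladderPath m hm s)).Nodup := by
  refine List.Nodup.map_on (fun i hi j hj h => ?_) List.nodup_range
  rw [List.mem_range] at hi hj
  rw [← level_ladderPath hm hs (show i ≤ m / 2 by omega), h, level_ladderPath hm hs (by omega)]

theorem eq_of_map_ladderPath_eq {m : ℕ} (hm : 0 < m) {s t : Finset ℕ}
    (hs : s ⊆ Icc 1 ((m - 1) / 2)) (ht : t ⊆ Icc 1 ((m - 1) / 2))
    (h : (List.range (m / 2 + 1)).map (ladderPath m hm s) =
      (List.range (m / 2 + 1)).map (ladderPath m hm t)) : s = t := by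
  have key : ∀ i ∈ Icc 1 ((m - 1) / 2), i ∈ s ↔ i ∈ t := by
    intro i hi
    rw [mem_Icc] at hi
    have h1 := congrArg Fin.val (List.map_inj_left.mp h i (List.mem_range.mpr (by omega)))
    rw [ladderPath_val hm hs (by omega), ladderPath_val hm ht (by omega)] at h1
    by_cases h2 : i ∈ s <;> by_cases h3 : i ∈ t <;> simp only [h2, h3, if_true, if_false] at h1 ⊢ <;>
      omega
  ext i
  exact ⟨fun hi => (key i (hs hi)).mp hi, fun hi => (key i (ht hi)).mpr hi⟩

theorem four_mul_two_pow_le_card_sq {m : ℕ} (hm : 2 ≤ m) [Fintype W] (hT : T.IsAcyclic)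
    (φ : T →g ladder m) (hinj : Function.Injective (pullback φ)) :
    4 * 2 ^ ((m - 1) / 2) ≤ Fintype.card W ^ 2 := by
  classical
  have hm0 : 0 < m := by omega
  have hlift : ∀ s : Finset ℕ, ∃ e : W × W, s ⊆ Icc 1 ((m - 1) / 2) →
      ∃ p : T.Walk e.1 e.2,
        p.support.map φ = (List.range (m / 2 + 1)).map (ladderPath m hm0 s) := by
    intro s
    by_cases hs : s ⊆ Icc 1 ((m - 1) / 2)
    · obtain ⟨b, a, p, hp⟩ := liftEnds_nonempty φ hinj (fun v => (v.val + 1) / 2)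
        (fun _ _ => Iff.rfl) (ladderPath m hm0 s) (m / 2) fun i hi => level_ladderPath hm0 hs hi
      exact ⟨(a, b), fun _ => ⟨p, hp⟩⟩
    · obtain ⟨b, -⟩ := liftEnds_nonempty φ hinj (fun v => (v.val + 1) / 2)
        (fun _ _ => Iff.rfl) (ladderPath m hm0 ∅) (m / 2)
        fun i hi => level_ladderPath hm0 (empty_subset _) hi
      exact ⟨(b, b), fun h => absurd h hs⟩
  choose e he using hlift
  let A : Finset W := univ.filter fun w => ((φ w).val + 1) / 2 = 0
  let B : Finset W := univ.filter fun w => ((φ w).val + 1) / 2 = m / 2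
  have hmaps : ∀ s ∈ (Icc 1 ((m - 1) / 2)).powerset, e s ∈ A ×ˢ B := by
    intro s hs
    rw [mem_powerset] at hs
    obtain ⟨p, hp⟩ := he s hs
    have hlast := map_of_mem_liftEnds (φ := φ) ⟨_, p, hp⟩
    have hfirst : φ (e s).1 = ladderPath m hm0 s 0 := by
      have h := congrArg List.head? hp
      rw [← SimpleGraph.Walk.cons_tail_support, List.range_succ_eq_map] at h
      exact Option.some.inj h
    simp only [A, B, mem_product, mem_filter, mem_univ, true_and]
    rw [hfirst, hlast]
    exact ⟨level_ladderPath hm0 hs (Nat.zero_le _), level_ladderPath hm0 hs le_rfl⟩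
  have hinjOn : Set.InjOn e ((Icc 1 ((m - 1) / 2)).powerset : Set (Finset ℕ)) := by
    intro s hs t ht hst
    rw [mem_coe, mem_powerset] at hs ht
    obtain ⟨p, hp⟩ := he s hs
    have het := he t ht
    rw [← hst] at het
    obtain ⟨q, hq⟩ := het
    exact eq_of_map_ladderPath_eq hm0 hs ht (map_eq_of_lifts_of_isAcyclic hT φ
      (nodup_map_ladderPath hm0 hs) (nodup_map_ladderPath hm0 ht) hp hq)
  have hcard := card_le_card_of_injOn e hmaps hinjOn
  rw [card_powerset, Nat.card_Icc, card_product, Nat.add_sub_cancel] at hcard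
  -- Since `m ≥ 2`, the last level `m / 2` is not `0`.
  have hdisj : Disjoint A B := by
    refine disjoint_filter.mpr fun w _ h1 h2 => ?_
    omega
  have hAB : A.card + B.card ≤ Fintype.card W := by
    rw [← card_union_of_disjoint hdisj]
    exact card_le_univ _
  calc 4 * 2 ^ ((m - 1) / 2) ≤ 4 * (A.card * B.card) := Nat.mul_le_mul_left 4 hcard
    _ = 4 * A.card * B.card := (mul_assoc _ _ _).symm
    _ ≤ (A.card + B.card) ^ 2 := four_mul_le_pow_two_add _ _
    _ ≤ Fintype.card W ^ 2 := Nat.pow_le_pow_left hAB 2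

end Counting

end RAAG

theorem theorem3p13 (m : ℕ) (hm : 2 ≤ m) {W : Type*} [Fintype W] (T : SimpleGraph W)
    (hT : T.IsTree) (φ : T →g RAAG.ladder m) (hφ : RAAG.IsImmersion φ)
    (hinj : Function.Injective (RAAG.pullback φ)) :
    (2 : ℝ) ^ ((m : ℝ) / 4) ≤ (Fintype.card W : ℝ) := by
  have h := RAAG.four_mul_two_pow_le_card_sq hm hT.isAcyclic φ hinj
  -- Fourth powers clear the exponent `m / 4`; the factor `4` from the AM-GM inequality absorbs the
  -- rounding in `(m - 1) / 2`.
  refine le_of_pow_le_pow_left₀ (n := 4) (by norm_num) (Nat.cast_nonneg _) ?_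
  rw [← Real.rpow_natCast, ← Real.rpow_mul (by norm_num)]
  have h1 : (m : ℝ) / 4 * ((4 : ℕ) : ℝ) = m := by push_cast; ring
  rw [h1, Real.rpow_natCast]
  have h2 : 2 ^ m ≤ Fintype.card W ^ 4 :=
    calc 2 ^ m ≤ 2 ^ (((m - 1) / 2 + 2) * 2) := Nat.pow_le_pow_right (by norm_num) (by omega)
      _ = (4 * 2 ^ ((m - 1) / 2)) ^ 2 := by rw [pow_mul, pow_add, mul_comm]; norm_num
      _ ≤ (Fintype.card W ^ 2) ^ 2 := Nat.pow_le_pow_left h 2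
      _ = Fintype.card W ^ 4 := by rw [← pow_mul]
  exact_mod_cast h2
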